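/- Let $\mathcal V$ be a variety of (finitary, single-sorted) universal algebras, i.e. the category of all algebras of some signature satisfying a given set of identities, with all homomorphisms. For an algebra $X$ in $\mathcal V$ let $\mathrm{Pt}_{\mathcal V}(X)$ be the category whose objects are the triples $(A,p,s)$ with homomorphisms $p:A\to X$, $s:X\to A$ such that $p\circ s=1_X$, and whose morphisms $(A,p,s)\to(B,q,t)$ are the homomorphisms $f:A\to B$ with $q\circ f=p$ and $f\circ s=t$; it is pointed, the zero morphism $(A,p,s)\to(B,q,t)$ being $t\circ p$. A normal epimorphism in a pointed category is a morphism that is a cokernel of some morphism. Theorem. The following conditions on $\mathcal V$ are equivalent. (1) For every $X$ in $\mathcal V$, the binary product of any two coequalizer diagrams in $\mathrm{Pt}_{\mathcal V}(X)$ is a coequalizer diagram: if $q_1:A\to A'$ is a coequalizer of $f,f':C_1\to A$ and $q_2:B\to B'$ is a coequalizer of $g,g':C_2\to B$ in $\mathrm{Pt}_{\mathcal V}(X)$, then $q_1\times q_2$ is a coequalizer of $f\times g,\ f'\times g':C_1\times C_2\to A\times B$ in $\mathrm{Pt}_{\mathcal V}(X)$. (2) For every $X$ in $\mathcal V$, the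 binary product of any two normal epimorphisms in $\mathrm{Pt}_{\mathcal V}(X)$ is a normal epimorphism. (3) $\mathcal V$ has normal local projections: for every $X$ in $\mathcal V$, every binary product projection in $\mathrm{Pt}_{\mathcal V}(X)$ is a normal epimorphism. (4) There are integers $m\ge 0$ and $n\ge 1$, binary terms $b_1,\dots,b_m,c_1,\dots,c_m$ and $(m+2)$-ary terms $p_1,\dots,p_n$ such that the following identities hold in $\mathcal V$: $$p_1(x,y,b_1(x,y),\dots,b_m(x,y))=x,\qquad p_n(y,x,b_1(x,y),\dots,b_m(x,y))=y,$$ $$p_i(y,x,b_1(x,y),\dots,b_m(x,y))=p_{i+1}(x,y,b_1(x,y),\dots,b_m(x,y))\quad(1\le i<n),$$ $$p_i(u,u,c_1(u,v),\dots,c_m(u,v))=v\quad(1\le i\le n),\qquad b_j(z,z)=c_j(z,z)\quad(1\le j\le m).$$ (5) For any homomorphisms $f:A\to X$ and $g:B\to X$ in $\mathcal V$ and any congruence $C$ on the pullback $A\times_X B=\{(a,b)\in A\times B: f(a)=g(b)\}$: whenever $(x,u),(y,u),(x,v),(y,v)\in A\times_X B$ and $(x,u)\mathrel{C}(y,u)$,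 then $(x,v)\mathrel{C}(y,v)$. -/

import Mathlib

open CategoryTheory CategoryTheory.Limits
open scoped FirstOrder

universe u v w

/-! ### Varieties of universal algebras

A signature of finitary operations is a first-order language `L` without relation symbols
(`L.IsAlgebraic`); a variety is the class of all `L`-algebras (the empty one is allowed if there
are no constants) satisfying a given set `E` of identities, with all homomorphisms. -/

/-- An algebra of the variety defined by the set `E` of identities `s = t`. -/
structure VarietyAlg {L : FirstOrder.Language.{u, v}} (E : Set (L.Term ℕ × L.Term ℕ)) where
  carrier : Type w
  [str : L.Structure carrier]
  sat : ∀ e ∈ E, ∀ a : ℕ → carrier, e.1.realize a = e.2.realize a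

namespace VarietyAlg

variable {L : FirstOrder.Language.{u, v}} {E : Set (L.Term ℕ × L.Term ℕ)}

instance : CoeSort (VarietyAlg.{u, v, w} E) (Type w) := ⟨carrier⟩

instance (A : VarietyAlg.{u, v, w} E) : L.Structure A := A.str

instance : Category (VarietyAlg.{u, v, w} E) where
  Hom A B := A →[L] B
  id A := FirstOrder.Language.Hom.id L A
  comp f g := g.comp f

end VarietyAlg

/-- A congruence on an `L`-algebra `M`: an equivalence relation compatible with all basic
operations. -/
structure AlgCongruence (L : FirstOrder.Language.{u, v}) (M : Type w) [L.Structure M] extends Setoid M where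
  funMap_rel : ∀ {n : ℕ} (F : L.Functions n) (a b : Fin n → M),
    (∀ i, r (a i) (b i)) → r (FirstOrder.Language.Structure.funMap F a) (FirstOrder.Language.Structure.funMap F b)

/-- The componentwise structure on the cartesian product. -/
instance prodAlgStructure {L : FirstOrder.Language.{u, v}} {M N : Type w} [L.Structure M] [L.Structure N] :
    L.Structure (M × N) where
  funMap F a := (FirstOrder.Language.Structure.funMap F fun i => (a i).1, FirstOrder.Language.Structure.funMap F fun i => (a i).2)
  RelMap R a := FirstOrder.Language.Structure.RelMap R (fun i => (a i).1) ∧ FirstOrder.Language.Structure.RelMap R (fun i => (a i).2)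

/-- The pullback `A ×_X B = {(a, b) | f a = g b}`, as a subalgebra of `A × B`. -/
def algPullback {L : FirstOrder.Language.{u, v}} {A B X : Type w} [L.Structure A] [L.Structure B]
    [L.Structure X] (f : A →[L] X) (g : B →[L] X) : L.Substructure (A × B) where
  carrier := {z | f z.1 = g z.2}
  fun_mem {n} F a ha := by
    change f (FirstOrder.Language.Structure.funMap F fun i => (a i).1) = g (FirstOrder.Language.Structure.funMap F fun i => (a i).2)
    rw [f.map_fun, g.map_fun]
    congr 1
    funext i
    exact ha i

/-- The shifting condition: for all homomorphisms `f : A → X`, `g : B → X` and every congruence `C`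
on `A ×_X B`, if `(x, t) C (y, t)` then `(x, z) C (y, z)`, whenever these four pairs belong to
`A ×_X B`. -/
def HasPullbackShifting {L : FirstOrder.Language.{u, v}} (E : Set (L.Term ℕ × L.Term ℕ)) : Prop :=
  ∀ (A B X : VarietyAlg.{u, v, w} E) (f : A →[L] X) (g : B →[L] X)
    (C : AlgCongruence L (algPullback f g)) (x y : A) (t z : B)
    (hxt : f x = g t) (hyt : f y = g t) (hxz : f x = g z) (hyz : f y = g z),
    C.r ⟨(x, t), hxt⟩ ⟨(y, t), hyt⟩ → C.r ⟨(x, z), hxz⟩ ⟨(y, z), hyz⟩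

/-- Janelidze's term condition. The terms `p₁, …, pₙ` (`n ≥ 1`) of the usual formulation are
indexed here by `Fin (n + 1)`; an identity holds in the variety if it holds in all its algebras. -/
def HasJanelidzeTerms {L : FirstOrder.Language.{u, v}} (E : Set (L.Term ℕ × L.Term ℕ)) : Prop :=
  ∃ (m n : ℕ) (b c : Fin m → L.Term (Fin 2)) (p : Fin (n + 1) → L.Term (Fin (m + 2))),
    ∀ A : VarietyAlg.{u, v, w} E,
      (∀ x y : A, (p 0).realize
        (Matrix.vecCons x (Matrix.vecCons y fun j => (b j).realize ![x, y])) = x) ∧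
      (∀ x y : A, (p (Fin.last n)).realize
        (Matrix.vecCons y (Matrix.vecCons x fun j => (b j).realize ![x, y])) = y) ∧
      (∀ (i : Fin n) (x y : A),
        (p i.castSucc).realize
          (Matrix.vecCons y (Matrix.vecCons x fun j => (b j).realize ![x, y])) =
        (p i.succ).realize
          (Matrix.vecCons x (Matrix.vecCons y fun j => (b j).realize ![x, y]))) ∧
      (∀ (i : Fin (n + 1)) (s t : A), (p i).realize
        (Matrix.vecCons s (Matrix.vecCons s fun j => (c j).realize ![s, t])) = t) ∧
      (∀ (j : Fin m) (z : A), (b j).realize ![z, z] = (c j).realize ![z, z])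

/-! ### Coequalizers, products and normal epimorphisms in a category -/

section Categorical

variable {D : Type u} [Category.{v} D]

/-- `C ⇉ A ⟶ Q` is a coequalizer diagram. -/
def IsCoequalizerDiagram {C A Q : D} (f g : C ⟶ A) (q : A ⟶ Q) : Prop :=
  ∃ h : f ≫ q = g ≫ q, Nonempty (IsColimit (Cofork.ofπ q h))

/-- The product `f × g` of two morphisms, with respect to given products of the domains and of the
codomains. -/
def productMap {A B A' B' : D} (c : BinaryFan A B) {d : BinaryFan A' B'} (hd : IsLimit d)
    (f : A ⟶ A') (g : B ⟶ B') : c.pt ⟶ d.pt :=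
  hd.lift (BinaryFan.mk (c.fst ≫ f) (c.snd ≫ g))

variable (D)

/-- Property (P): the product of two coequalizer diagrams is a coequalizer diagram. -/
def SatisfiesP : Prop :=
  ∀ {C₁ A A' C₂ B B' : D} (f f' : C₁ ⟶ A) (q₁ : A ⟶ A') (g g' : C₂ ⟶ B) (q₂ : B ⟶ B'),
    IsCoequalizerDiagram f f' q₁ → IsCoequalizerDiagram g g' q₂ →
    ∀ (c : BinaryFan C₁ C₂) (d : BinaryFan A B) (e : BinaryFan A' B')
      (_ : IsLimit c) (hd : IsLimit d) (he : IsLimit e),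
      IsCoequalizerDiagram (productMap c hd f g) (productMap c hd f' g') (productMap d he q₁ q₂)

/-- The product of two normal epimorphisms is a normal epimorphism. -/
def NormalEpisClosedUnderProducts [HasZeroMorphisms D] : Prop :=
  ∀ {A A' B B' : D} (f : A ⟶ A') (g : B ⟶ B'),
    Nonempty (NormalEpi f) → Nonempty (NormalEpi g) →
    ∀ (c : BinaryFan A B) (d : BinaryFan A' B') (_ : IsLimit c) (hd : IsLimit d),
      Nonempty (NormalEpi (productMap c hd f g))

/-- Normal projections: every product projection is a normal epimorphism. -/
def HasNormalProjections [HasZeroMorphisms D] : Prop :=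
  ∀ {A B : D} (c : BinaryFan A B), IsLimit c →
    Nonempty (NormalEpi c.fst) ∧ Nonempty (NormalEpi c.snd)

/-! ### The category of points -/

variable {D}

/-- An object of `Pt(X)`: a split epimorphism `p : A ⟶ X` with a splitting `s`. -/
structure Pt (X : D) where
  A : D
  p : A ⟶ X
  s : X ⟶ A
  s_p : s ≫ p = 𝟙 X

namespace Pt

variable {X : D}

/-- A morphism of `Pt(X)`. -/
@[ext]
structure Hom (P Q : Pt X) where
  f : P.A ⟶ Q.A
  f_p : f ≫ Q.p = P.p
  s_f : P.s ≫ f = Q.s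

instance : Category (Pt X) where
  Hom P Q := Hom P Q
  id P := ⟨𝟙 P.A, by simp, by simp⟩
  comp g h := ⟨g.f ≫ h.f, by rw [Category.assoc, h.f_p, g.f_p],
    by rw [← Category.assoc, g.s_f, h.s_f]⟩

/-- The zero morphism `(A, p, s) ⟶ (B, q, t)` is `t ∘ p`. -/
instance : HasZeroMorphisms (Pt X) where
  zero P Q := ⟨⟨P.p ≫ Q.s, by rw [Category.assoc, Q.s_p, Category.comp_id],
    by rw [← Category.assoc, P.s_p, Category.id_comp]⟩⟩
  comp_zero g R := Hom.ext (by
    change g.f ≫ _ ≫ R.s = _ ≫ R.s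
    rw [← Category.assoc, g.f_p])
  zero_comp P {Q R} g := Hom.ext (by
    change (P.p ≫ Q.s) ≫ g.f = P.p ≫ R.s
    rw [Category.assoc, g.s_f])

end Pt

end Categorical

/-!
For points `P = (A, p, s)` and `Q` over `X`, the product in `Pt(X)` is the pullback of the
projections to `X`, and `(𝟙, 0) : P ⟶ P × Q` is `a ↦ (a, s p a)`, with `s` the section of `Q`.

Products of normal epimorphisms are normal when products of coequalizer diagrams are coequalizer
diagrams, because `0 × 0 = 0`; and a product projection is the product of an identity and a morphism
to the zero object, which are normal epimorphisms. Both steps hold in any pointed category with the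
relevant products (`SatisfiesP.normalEpisClosedUnderProducts`,
`NormalEpisClosedUnderProducts.hasNormalProjections`).

From normal projections to terms, take the free algebra on `x, y` as a point over the free algebra on
one generator, with the section `x`, and its square in the category of points. Normality of the
second projection says that its kernel congruence is generated by the pairs
`(a, s p a), (s p a, s p a)`; as the algebra is free on `x, y`, the single pair `(x, x), (y, x)`
generates it (`HasNormalProjections.principalCongruence_rel`). In particular `(x, y)` and `(y, y)` are
linked by a Mal'cev chain for the congruence generated by `(x, x), (y, x)`. Each step of the chain is
a term with parameters, evaluated with the generating pair in the two orders. The terms of the chain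
are the `p i`, and the two components of the parameters are the `b j` and `c j`; these agree on the
diagonal since the parameters lie in the pullback (`HasNormalProjections.hasJanelidzeTerms`).

Conversely, the terms carry a congruent pair `(x, t), (y, t)` along such a chain to `(x, z), (y, z)`
(`HasJanelidzeTerms.hasPullbackShifting`).

Finally, a coequalizer in `Pt(X)` is surjective. Therefore, to see that a product `q₁ × q₂` of
coequalizers is a coequalizer, it suffices that the kernel of every `k` coequalizing the product pair
contains the kernel of `q₁ × q₂`. Restricting `k` along `(𝟙, 0)` and `(0, 𝟙)` gives this for pairs of
elements in the images of these two inclusions, and shifting extends it to all pairs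
(`HasPullbackShifting.satisfiesP`).
-/

/-! ### Coequalizer diagrams and normal epimorphisms -/

section Categorical

variable {D : Type u} [Category.{v} D]

theorem isCoequalizerDiagram_iff {C A Q : D} {f g : C ⟶ A} {q : A ⟶ Q} :
    IsCoequalizerDiagram f g q ↔
      f ≫ q = g ≫ q ∧ ∀ (Z : D) (k : A ⟶ Z), f ≫ k = g ≫ k → ∃! l : Q ⟶ Z, q ≫ l = k := by
  constructor
  · rintro ⟨h, ⟨hq⟩⟩
    exact ⟨h, fun Z k hk => Cofork.IsColimit.existsUnique hq k hk⟩
  · rintro ⟨h, hq⟩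
    exact ⟨h, ⟨Cofork.IsColimit.ofExistsUnique fun s => hq s.pt s.π s.condition⟩⟩

theorem nonempty_normalEpi_iff [HasZeroMorphisms D] {A Q : D} {q : A ⟶ Q} :
    Nonempty (NormalEpi q) ↔ ∃ (W : D) (g : W ⟶ A), IsCoequalizerDiagram g 0 q := by
  constructor
  · rintro ⟨h⟩
    exact ⟨h.W, h.g, by rw [h.w, zero_comp], ⟨h.isColimit⟩⟩
  · rintro ⟨W, g, h, ⟨hq⟩⟩
    exact ⟨⟨W, g, by rw [h, zero_comp], hq⟩⟩

@[simp]
theorem productMap_fst {A B A' B' : D} (c : BinaryFan A B) {d : BinaryFan A' B'} (hd : IsLimit d)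
    (f : A ⟶ A') (g : B ⟶ B') : productMap c hd f g ≫ d.fst = c.fst ≫ f :=
  hd.fac (BinaryFan.mk (c.fst ≫ f) (c.snd ≫ g)) ⟨WalkingPair.left⟩

@[simp]
theorem productMap_snd {A B A' B' : D} (c : BinaryFan A B) {d : BinaryFan A' B'} (hd : IsLimit d)
    (f : A ⟶ A') (g : B ⟶ B') : productMap c hd f g ≫ d.snd = c.snd ≫ g :=
  hd.fac (BinaryFan.mk (c.fst ≫ f) (c.snd ≫ g)) ⟨WalkingPair.right⟩

theorem comp_productMap_fst {T A B A' B' : D} {c : BinaryFan A B} {d : BinaryFan A' B'}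
    (hd : IsLimit d) (f : A ⟶ A') (g : B ⟶ B') {x : T ⟶ c.pt} {a : T ⟶ A} (h : x ≫ c.fst = a) :
    (x ≫ productMap c hd f g) ≫ d.fst = a ≫ f :=
  (Category.assoc _ _ _).trans <| (whisker_eq x (productMap_fst c hd f g)).trans <|
    (Category.assoc _ _ _).symm.trans (eq_whisker h f)

theorem comp_productMap_snd {T A B A' B' : D} {c : BinaryFan A B} {d : BinaryFan A' B'}
    (hd : IsLimit d) (f : A ⟶ A') (g : B ⟶ B') {x : T ⟶ c.pt} {b : T ⟶ B} (h : x ≫ c.snd = b) :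
    (x ≫ productMap c hd f g) ≫ d.snd = b ≫ g :=
  (Category.assoc _ _ _).trans <| (whisker_eq x (productMap_snd c hd f g)).trans <|
    (Category.assoc _ _ _).symm.trans (eq_whisker h g)

theorem productMap_comp {A B A' B' A'' B'' : D} (c : BinaryFan A B) {d : BinaryFan A' B'}
    (hd : IsLimit d) {e : BinaryFan A'' B''} (he : IsLimit e) (f : A ⟶ A') (g : B ⟶ B')
    (f' : A' ⟶ A'') (g' : B' ⟶ B'') :
    productMap c hd f g ≫ productMap d he f' g' = productMap c he (f ≫ f') (g ≫ g') := by
  apply BinaryFan.IsLimit.hom_ext he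
  · rw [comp_productMap_fst he f' g' (productMap_fst c hd f g), productMap_fst]
    exact Category.assoc _ _ _
  · rw [comp_productMap_snd he f' g' (productMap_snd c hd f g), productMap_snd]
    exact Category.assoc _ _ _

/-- The inclusion `(𝟙, 0) : A ⟶ A × B`. -/
def productInl [HasZeroMorphisms D] {A B : D} {d : BinaryFan A B} (hd : IsLimit d) : A ⟶ d.pt :=
  hd.lift (BinaryFan.mk (𝟙 A) 0)

/-- The inclusion `(0, 𝟙) : B ⟶ A × B`. -/
def productInr [HasZeroMorphisms D] {A B : D} {d : BinaryFan A B} (hd : IsLimit d) : B ⟶ d.pt :=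
  hd.lift (BinaryFan.mk 0 (𝟙 B))

section ProductInclusion

variable [HasZeroMorphisms D] {A B : D} {d : BinaryFan A B} (hd : IsLimit d)

@[simp]
theorem productInl_fst : productInl hd ≫ d.fst = 𝟙 A :=
  hd.fac (BinaryFan.mk (𝟙 A) 0) ⟨WalkingPair.left⟩

@[simp]
theorem productInl_snd : productInl hd ≫ d.snd = 0 :=
  hd.fac (BinaryFan.mk (𝟙 A) 0) ⟨WalkingPair.right⟩

@[simp]
theorem productInr_fst : productInr hd ≫ d.fst = 0 :=
  hd.fac (BinaryFan.mk 0 (𝟙 B)) ⟨WalkingPair.left⟩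

@[simp]
theorem productInr_snd : productInr hd ≫ d.snd = 𝟙 B :=
  hd.fac (BinaryFan.mk 0 (𝟙 B)) ⟨WalkingPair.right⟩

theorem productInl_productMap {C₁ C₂ : D} {c : BinaryFan C₁ C₂} (hc : IsLimit c) (f : C₁ ⟶ A)
    (g : C₂ ⟶ B) : productInl hc ≫ productMap c hd f g = f ≫ productInl hd := by
  apply BinaryFan.IsLimit.hom_ext hd
  · rw [comp_productMap_fst hd f g (productInl_fst hc), Category.assoc, productInl_fst]
    exact (Category.id_comp f).trans (Category.comp_id f).symm
  · rw [comp_productMap_snd hd f g (productInl_snd hc), Category.assoc, productInl_snd]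
    exact zero_comp.trans comp_zero.symm

theorem productInr_productMap {C₁ C₂ : D} {c : BinaryFan C₁ C₂} (hc : IsLimit c) (f : C₁ ⟶ A)
    (g : C₂ ⟶ B) : productInr hc ≫ productMap c hd f g = g ≫ productInr hd := by
  apply BinaryFan.IsLimit.hom_ext hd
  · rw [comp_productMap_fst hd f g (productInr_fst hc), Category.assoc, productInr_fst]
    exact zero_comp.trans comp_zero.symm
  · rw [comp_productMap_snd hd f g (productInr_snd hc), Category.assoc, productInr_snd]
    exact (Category.id_comp g).trans (Category.comp_id g).symm

/-- `(𝟙, 0) : A ⟶ A × B` is a kernel of the projection to `B`. Hence this projection, if it is a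
normal epimorphism, is a cokernel of `(𝟙, 0)`. -/
theorem exists_snd_comp_eq (h : Nonempty (NormalEpi d.snd)) {Z : D} (π : d.pt ⟶ Z)
    (hπ : productInl hd ≫ π = 0) : ∃ l : B ⟶ Z, d.snd ≫ l = π := by
  obtain ⟨W, k, hk⟩ := nonempty_normalEpi_iff.1 h
  obtain ⟨hk0, huniv⟩ := isCoequalizerDiagram_iff.1 hk
  let a : W ⟶ A := k ≫ d.fst
  have ha : k = a ≫ productInl hd := by
    apply BinaryFan.IsLimit.hom_ext hd
    · rw [Category.assoc, productInl_fst]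
      exact (Category.comp_id a).symm
    · rw [Category.assoc, productInl_snd, hk0]
      exact zero_comp.trans comp_zero.symm
  have hkπ : k ≫ π = 0 ≫ π := by
    rw [ha, Category.assoc, hπ, comp_zero, zero_comp]
  exact (huniv Z π hkπ).exists

end ProductInclusion

theorem SatisfiesP.normalEpisClosedUnderProducts [HasZeroMorphisms D] [HasBinaryProducts D]
    (hP : SatisfiesP D) : NormalEpisClosedUnderProducts D := by
  intro A A' B B' f g hf hg c d hc hd
  obtain ⟨W, k, hk⟩ := nonempty_normalEpi_iff.1 hf
  obtain ⟨V, l, hl⟩ := nonempty_normalEpi_iff.1 hg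
  have h := hP k 0 f l 0 g hk hl _ c d (prodIsProd W V) hc hd
  have h0 : productMap (BinaryFan.mk (prod.fst : W ⨯ V ⟶ W) prod.snd) hc 0 0 = 0 :=
    BinaryFan.IsLimit.hom_ext hc 
      ((productMap_fst _ _ _ _).trans (comp_zero.trans zero_comp.symm))
      ((productMap_snd _ _ _ _).trans (comp_zero.trans zero_comp.symm))
  rw [h0] at h
  exact nonempty_normalEpi_iff.2 ⟨_, _, h⟩

/-- The projection `A × B ⟶ A` is the product of `𝟙 A` and `B ⟶ 0`, the cokernels of `0 ⟶ A` and of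
`𝟙 B`. -/
theorem NormalEpisClosedUnderProducts.hasNormalProjections [HasZeroMorphisms D] [HasZeroObject D]
    (h : NormalEpisClosedUnderProducts D) : HasNormalProjections D := by
  open scoped ZeroObject in
  have h1 (A : D) : Nonempty (NormalEpi (𝟙 A)) :=
    nonempty_normalEpi_iff.2 ⟨A, 0, isCoequalizerDiagram_iff.2
      ⟨rfl, fun Z k _ => ⟨k, Category.id_comp k, fun l hl => by simpa using hl⟩⟩⟩
  have h2 (A : D) : Nonempty (NormalEpi (0 : A ⟶ 0)) :=
    nonempty_normalEpi_iff.2 ⟨A, 𝟙 A, isCoequalizerDiagram_iff.2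
      ⟨by simp, fun Z k hk => ⟨0, by simpa using hk.symm, fun l _ => (isZero_zero D).eq_of_src _ _⟩⟩⟩
  intro A B c hc
  constructor
  · have hd : IsLimit (BinaryFan.mk (𝟙 A) (0 : A ⟶ 0)) :=
      BinaryFan.isLimitMk (fun s => s.fst) (fun s => Category.comp_id _)
        (fun s => (isZero_zero D).eq_of_tgt _ _) (fun s m hm _ => by simpa using hm)
    have := h (𝟙 A) (0 : B ⟶ 0) (h1 A) (h2 B) c _ hc hd
    have e : productMap c hd (𝟙 A) (0 : B ⟶ 0) = c.fst :=
      (Category.comp_id _).symm.trans ((productMap_fst c hd _ _).trans (Category.comp_id _))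
    rwa [e] at this
  · have hd : IsLimit (BinaryFan.mk (0 : B ⟶ 0) (𝟙 B)) :=
      BinaryFan.isLimitMk (fun s => s.snd) (fun s => (isZero_zero D).eq_of_tgt _ _)
        (fun s => Category.comp_id _) (fun s m _ hm => by simpa using hm)
    have := h (0 : A ⟶ 0) (𝟙 B) (h2 A) (h1 B) c _ hc hd
    have e : productMap c hd (0 : A ⟶ 0) (𝟙 B) = c.snd :=
      (Category.comp_id _).symm.trans ((productMap_snd c hd _ _).trans (Category.comp_id _))
    rwa [e] at this

namespace Pt

variable {X : D}

@[simp]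
theorem comp_f {P Q R : Pt X} (g : P ⟶ Q) (h : Q ⟶ R) : (g ≫ h).f = g.f ≫ h.f := rfl

@[simp]
theorem zero_f (P Q : Pt X) : Hom.f (0 : P ⟶ Q) = P.p ≫ Q.s := rfl

theorem hom_ext {P Q : Pt X} {g h : P ⟶ Q} (e : g.f = h.f) : g = h := Hom.ext e

/-- The point `(X, 𝟙, 𝟙)` is a zero object. -/
instance : HasZeroObject (Pt X) where
  zero := ⟨⟨X, 𝟙 X, 𝟙 X, Category.comp_id _⟩,
    { unique_to := fun Q => ⟨⟨⟨0⟩, fun g => hom_ext (by simpa using g.s_f)⟩⟩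
      unique_from := fun Q => ⟨⟨⟨0⟩, fun g => hom_ext (by simpa using g.f_p)⟩⟩ }⟩

end Pt

end Categorical

/-! ### Homomorphisms, quotients and pullbacks of algebras -/

section Algebra

open FirstOrder FirstOrder.Language

variable {L : FirstOrder.Language.{u, v}}

/-- Without relation symbols, a homomorphism is a map that commutes with the basic operations. -/
def homOfMapFun [L.IsAlgebraic] {M N : Type*} [L.Structure M] [L.Structure N] (φ : M → N)
    (hφ : ∀ {n : ℕ} (F : L.Functions n) (a : Fin n → M),
      φ (Structure.funMap F a) = Structure.funMap F fun i => φ (a i)) : M →[L] N where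
  toFun := φ
  map_fun' F a := hφ F a
  map_rel' R := isEmptyElim R

namespace AlgCongruence

variable {M : Type w} [L.Structure M]

/-- The kernel congruence of a homomorphism. -/
def ker {N : Type*} [L.Structure N] (f : M →[L] N) : AlgCongruence L M where
  toSetoid := Setoid.ker f
  funMap_rel F a b h := by
    change f _ = f _
    rw [f.map_fun, f.map_fun]
    congr 1
    funext i
    exact h i

instance [L.IsAlgebraic] (R : AlgCongruence L M) : L.Prestructure R.toSetoid where
  toStructure := inferInstance
  fun_equiv a b h := R.funMap_rel _ a b h
  rel_equiv {_ r} := isEmptyElim r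

end AlgCongruence

namespace VarietyAlg

variable {E : Set (L.Term ℕ × L.Term ℕ)}

/-- The homomorphism of algebras underlying a morphism. -/
def toHom {A B : VarietyAlg.{u, v, w} E} (f : A ⟶ B) : A →[L] B := f

/-- A homomorphism of algebras as a morphism of the variety. -/
def ofHom {A B : VarietyAlg.{u, v, w} E} (f : A →[L] B) : A ⟶ B := f

@[simp]
theorem toHom_comp {A B C : VarietyAlg.{u, v, w} E} (f : A ⟶ B) (g : B ⟶ C) (x : A) :
    toHom (f ≫ g) x = toHom g (toHom f x) := rfl

theorem hom_ext {A B : VarietyAlg.{u, v, w} E} {f g : A ⟶ B} (h : ∀ x, toHom f x = toHom g x) :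
    f = g :=
  FirstOrder.Language.Hom.ext h

/-- The quotient of an algebra of a variety by a congruence. -/
def quotient [L.IsAlgebraic] (A : VarietyAlg.{u, v, w} E) (R : AlgCongruence L A) :
    VarietyAlg.{u, v, w} E where
  carrier := Quotient R.toSetoid
  sat e he a := by
    obtain ⟨a, rfl⟩ : ∃ b : ℕ → A, a = fun i => ⟦b i⟧ :=
      ⟨fun i => (a i).out, funext fun i => (Quotient.out_eq _).symm⟩
    rw [Term.realize_quotient_mk', Term.realize_quotient_mk']
    exact congrArg _ (A.sat e he a)

/-- The projection onto a quotient algebra. -/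
def quotientMk [L.IsAlgebraic] (A : VarietyAlg.{u, v, w} E) (R : AlgCongruence L A) :
    A ⟶ A.quotient R :=
  ofHom (homOfMapFun (fun a => (⟦a⟧ : Quotient R.toSetoid))
    fun F a => (funMap_quotient_mk' R.toSetoid F a).symm)

theorem quotientMk_surjective [L.IsAlgebraic] (A : VarietyAlg.{u, v, w} E)
    (R : AlgCongruence L A) : Function.Surjective (toHom (A.quotientMk R)) :=
  Quotient.mk_surjective

theorem quotientMk_eq_iff [L.IsAlgebraic] {A : VarietyAlg.{u, v, w} E} {R : AlgCongruence L A}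
    {a b : A} : toHom (A.quotientMk R) a = toHom (A.quotientMk R) b ↔ R.r a b :=
  Quotient.eq

/-- The morphism induced on the codomain of a surjective homomorphism `q` by a homomorphism that
identifies whatever `q` identifies. -/
theorem exists_factorization [L.IsAlgebraic] {A B Z : VarietyAlg.{u, v, w} E} {q : A ⟶ B}
    (hq : Function.Surjective (toHom q)) (k : A ⟶ Z)
    (hk : ∀ a b, toHom q a = toHom q b → toHom k a = toHom k b) : ∃ l : B ⟶ Z, q ≫ l = k := by
  choose σ hσ using hq
  refine ⟨ofHom (homOfMapFun (fun b => toHom k (σ b)) fun F b => ?_), hom_ext fun a => ?_⟩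
  · refine (hk _ _ ?_).trans (Hom.map_fun (toHom k) F fun i => σ (b i))
    rw [hσ, Hom.map_fun]
    congr 1
    funext i
    exact (hσ (b i)).symm
  · exact hk _ _ (hσ _)

end VarietyAlg

section Pullback

variable {A B X : Type w} [L.Structure A] [L.Structure B] [L.Structure X]
  (f : A →[L] X) (g : B →[L] X)

variable [L.IsAlgebraic]

/-- The first projection `A ×_X B → A`. -/
def algPullbackFst : algPullback f g →[L] A := homOfMapFun (fun z => z.1.1) fun _ _ => rfl

/-- The second projection `A ×_X B → B`. -/
def algPullbackSnd : algPullback f g →[L] B := homOfMapFun (fun z => z.1.2) fun _ _ => rfl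

variable {f g}

theorem algPullback_condition (z : algPullback f g) :
    f (algPullbackFst f g z) = g (algPullbackSnd f g z) := z.2

theorem algPullback_ext {z z' : algPullback f g}
    (h1 : algPullbackFst f g z = algPullbackFst f g z')
    (h2 : algPullbackSnd f g z = algPullbackSnd f g z') : z = z' :=
  Subtype.ext (Prod.ext h1 h2)

/-- The homomorphism into `A ×_X B` with prescribed components. -/
def algPullbackLift {C : Type*} [L.Structure C] (h : C →[L] A) (k : C →[L] B)
    (e : ∀ c, f (h c) = g (k c)) : C →[L] algPullback f g :=
  homOfMapFun (fun c => ⟨(h c, k c), e c⟩) fun F a =>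
    algPullback_ext (h.map_fun F a) (k.map_fun F a)

end Pullback

namespace VarietyAlg

variable {E : Set (L.Term ℕ × L.Term ℕ)} [L.IsAlgebraic]

/-- The algebra `A ×_X B` of a variety, for homomorphisms `f : A → X` and `g : B → X`. -/
def pullback {A B X : VarietyAlg.{u, v, w} E} (f : A →[L] X) (g : B →[L] X) :
    VarietyAlg.{u, v, w} E where
  carrier := algPullback f g
  sat e he a := by
    apply algPullback_ext
    · rw [← HomClass.realize_term, ← HomClass.realize_term]
      exact A.sat e he _
    · rw [← HomClass.realize_term, ← HomClass.realize_term]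
      exact B.sat e he _

end VarietyAlg

/-! ### Points over an algebra -/

namespace Pt

open VarietyAlg

variable {E : Set (L.Term ℕ × L.Term ℕ)} {X : VarietyAlg.{u, v, w} E}

@[simp]
theorem toHom_s_p (P : Pt X) (x : X) : toHom P.p (toHom P.s x) = x :=
  congrArg (fun h : X ⟶ X => toHom h x) P.s_p

@[simp]
theorem toHom_f_p {P Q : Pt X} (g : P ⟶ Q) (a : P.A) :
    toHom Q.p (toHom (Hom.f g) a) = toHom P.p a :=
  congrArg (fun h : P.A ⟶ X => toHom h a) (Hom.f_p g)

@[simp]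
theorem toHom_s_f {P Q : Pt X} (g : P ⟶ Q) (x : X) :
    toHom (Hom.f g) (toHom P.s x) = toHom Q.s x :=
  congrArg (fun h : X ⟶ Q.A => toHom h x) (Hom.s_f g)

theorem toHom_ext {P Q : Pt X} {g h : P ⟶ Q}
    (e : ∀ a, toHom (Hom.f g) a = toHom (Hom.f h) a) : g = h :=
  hom_ext (VarietyAlg.hom_ext e)

theorem toHom_congr {P Q : Pt X} {g h : P ⟶ Q} (e : g = h) (a : P.A) :
    toHom (Hom.f g) a = toHom (Hom.f h) a := by rw [e]

variable [L.IsAlgebraic]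

/-- The quotient of a point over `X` by a congruence contained in the kernel of its projection. -/
theorem exists_quotient (P : Pt X) (R : AlgCongruence L P.A)
    (hR : ∀ a b, R.r a b → toHom P.p a = toHom P.p b) :
    ∃ (Q : Pt X) (π : P ⟶ Q), Function.Surjective (toHom (Hom.f π)) ∧
      ∀ a b, toHom (Hom.f π) a = toHom (Hom.f π) b ↔ R.r a b := by
  obtain ⟨p, hp⟩ := exists_factorization (quotientMk_surjective P.A R) P.p
    fun a b h => hR a b (quotientMk_eq_iff.1 h)
  refine ⟨⟨P.A.quotient R, p, P.s ≫ quotientMk P.A R, ?_⟩, ⟨quotientMk P.A R, hp, rfl⟩,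
    quotientMk_surjective P.A R, fun a b => quotientMk_eq_iff⟩
  rw [Category.assoc, hp, P.s_p]

theorem exists_factorization {P Q Z : Pt X} {q : P ⟶ Q}
    (hq : Function.Surjective (toHom (Hom.f q))) (k : P ⟶ Z)
    (hk : ∀ a b, toHom (Hom.f q) a = toHom (Hom.f q) b → toHom (Hom.f k) a = toHom (Hom.f k) b) :
    ∃ l : Q ⟶ Z, q ≫ l = k := by
  obtain ⟨l, hl⟩ := VarietyAlg.exists_factorization hq k.f hk
  have hl' (a) : toHom l (toHom q.f a) = toHom k.f a :=
    congrArg (fun h : P.A ⟶ Z.A => toHom h a) hl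
  refine ⟨⟨l, VarietyAlg.hom_ext fun b => ?_, VarietyAlg.hom_ext fun x => ?_⟩, hom_ext hl⟩
  · obtain ⟨a, rfl⟩ := hq b
    rw [toHom_comp, hl', toHom_f_p, toHom_f_p]
  · rw [toHom_comp, ← toHom_s_f q, hl', toHom_s_f]

theorem coequalizer_surjective {C A Q : Pt X} {f g : C ⟶ A} {q : A ⟶ Q}
    (h : IsCoequalizerDiagram f g q) : Function.Surjective (toHom (Hom.f q)) := by
  obtain ⟨hfg, huniv⟩ := isCoequalizerDiagram_iff.1 h
  obtain ⟨K, π, hπ, hker⟩ := exists_quotient A (AlgCongruence.ker (toHom q.f)) fun a b hab => by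
    rw [← toHom_f_p q, ← toHom_f_p q]
    exact congrArg _ hab
  obtain ⟨j, hj⟩ := exists_factorization hπ q fun a b hab => (hker a b).1 hab
  obtain ⟨k, hk, -⟩ := huniv K π (toHom_ext fun c => (hker _ _).2 (toHom_congr hfg c))
  -- `k ≫ j` is the identity since `q` is epi, so that `q = π ≫ j` is surjective along with `j`
  obtain ⟨l, -, hl⟩ := huniv Q q hfg
  have hkj : k ≫ j = 𝟙 Q := (hl _ (by simp only [← Category.assoc, hk, hj])).trans
    (hl _ (Category.comp_id q)).symm
  intro b
  obtain ⟨a, ha⟩ := hπ (toHom (Hom.f k) b)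
  refine ⟨a, ?_⟩
  rw [← hj, comp_f, toHom_comp, ha]
  exact toHom_congr hkj b

theorem isCoequalizerDiagram_of_surjective {C A Q : Pt X} {f g : C ⟶ A} {q : A ⟶ Q}
    (h : f ≫ q = g ≫ q) (hq : Function.Surjective (toHom (Hom.f q)))
    (hker : ∀ (Z : Pt X) (k : A ⟶ Z), f ≫ k = g ≫ k →
      ∀ a b, toHom (Hom.f q) a = toHom (Hom.f q) b → toHom (Hom.f k) a = toHom (Hom.f k) b) :
    IsCoequalizerDiagram f g q := by
  refine isCoequalizerDiagram_iff.2 ⟨h, fun Z k hk => ?_⟩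
  obtain ⟨l, hl⟩ := exists_factorization hq k (hker Z k hk)
  refine ⟨l, hl, fun l' hl' => toHom_ext fun b => ?_⟩
  obtain ⟨a, rfl⟩ := hq b
  exact toHom_congr (hl'.trans hl.symm) a

/-- The product of two points over `X`: the pullback of their projections. -/
def prod (P Q : Pt X) : Pt X where
  A := pullback (toHom P.p) (toHom Q.p)
  p := ofHom ((toHom P.p).comp (algPullbackFst (toHom P.p) (toHom Q.p)))
  s := ofHom (algPullbackLift (toHom P.s) (toHom Q.s) fun x => by simp)
  s_p := P.s_p

/-- The projections of the product of two points. -/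
def prodFan (P Q : Pt X) : BinaryFan P Q :=
  BinaryFan.mk (P := prod P Q)
    ⟨ofHom (algPullbackFst (toHom P.p) (toHom Q.p)), rfl, rfl⟩
    ⟨ofHom (algPullbackSnd (toHom P.p) (toHom Q.p)),
      VarietyAlg.hom_ext fun z => (algPullback_condition z).symm, rfl⟩

/-- The pullback of the projections is a categorical product. -/
def prodFanIsLimit (P Q : Pt X) : IsLimit (prodFan P Q) :=
  BinaryFan.isLimitMk
    (fun c => ⟨ofHom (algPullbackLift (toHom (Hom.f c.fst)) (toHom (Hom.f c.snd))
      fun z => (toHom_f_p c.fst z).trans (toHom_f_p c.snd z).symm), Hom.f_p c.fst,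
      VarietyAlg.hom_ext fun x => algPullback_ext (toHom_s_f c.fst x) (toHom_s_f c.snd x)⟩)
    (fun _ => rfl) (fun _ => rfl)
    (fun _ _ h1 h2 => toHom_ext fun z => algPullback_ext (toHom_congr h1 z) (toHom_congr h2 z))

instance : HasBinaryProducts (Pt X) :=
  have (P Q : Pt X) : HasLimit (pair P Q) := ⟨⟨⟨_, prodFanIsLimit P Q⟩⟩⟩
  hasBinaryProducts_of_hasLimit_pair (Pt X)

end Pt

end Algebra

section Shifting

open FirstOrder FirstOrder.Language VarietyAlg

variable {L : FirstOrder.Language.{u, v}} {E : Set (L.Term ℕ × L.Term ℕ)}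

/-! ### Shifting implies that products preserve coequalizers -/

namespace Pt

variable {X : VarietyAlg.{u, v, w} E} {A B : Pt X} {d : BinaryFan A B} (hd : IsLimit d)

/-- The isomorphism from the pullback of the projections to a given product of points. -/
def prodComparison [L.IsAlgebraic] : prod A B ⟶ d.pt := hd.lift (prodFan A B)

theorem fst_prodComparison [L.IsAlgebraic] (z : (prod A B).A) :
    toHom (Hom.f d.fst) (toHom (Hom.f (prodComparison hd)) z) = algPullbackFst _ _ z :=
  toHom_congr (hd.fac (prodFan A B) ⟨WalkingPair.left⟩) z

theorem snd_prodComparison [L.IsAlgebraic] (z : (prod A B).A) :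
    toHom (Hom.f d.snd) (toHom (Hom.f (prodComparison hd)) z) = algPullbackSnd _ _ z :=
  toHom_congr (hd.fac (prodFan A B) ⟨WalkingPair.right⟩) z

theorem ext_of_isLimit [L.IsAlgebraic] {d : BinaryFan A B} (hd : IsLimit d) {z z' : d.pt.A} (h1 : toHom (Hom.f d.fst) z = toHom (Hom.f d.fst) z')
    (h2 : toHom (Hom.f d.snd) z = toHom (Hom.f d.snd) z') : z = z' := by
  have hj : (prodFanIsLimit A B).lift d ≫ prodComparison hd = 𝟙 d.pt := by
    apply BinaryFan.IsLimit.hom_ext hd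
    · exact toHom_ext fun z => fst_prodComparison hd _
    · exact toHom_ext fun z => snd_prodComparison hd _
  have e : toHom (Hom.f ((prodFanIsLimit A B).lift d)) z =
      toHom (Hom.f ((prodFanIsLimit A B).lift d)) z' := algPullback_ext h1 h2
  exact (toHom_congr hj z).symm.trans ((congrArg _ e).trans (toHom_congr hj z'))

end Pt

/-- The shifting condition for the kernel of a homomorphism. -/
theorem HasPullbackShifting.map_eq (h : HasPullbackShifting.{u, v, w} E)
    {A B X : VarietyAlg.{u, v, w} E} {f : A →[L] X} {g : B →[L] X} {Z : Type*} [L.Structure Z]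
    (k : algPullback f g →[L] Z) {x y : A} {t z : B} (hxt : f x = g t) (hyt : f y = g t)
    (hxz : f x = g z) (hyz : f y = g z) (e : k ⟨(x, t), hxt⟩ = k ⟨(y, t), hyt⟩) :
    k ⟨(x, z), hxz⟩ = k ⟨(y, z), hyz⟩ :=
  h A B X f g (AlgCongruence.ker k) x y t z hxt hyt hxz hyz e

/-- Write `q₁ × q₂` for the product of the given coequalizers. A morphism `k` coequalizing the
product pair identifies `(a, s p a)` with `(a', s p a')` when `q₁ a = q₁ a'`, since its restriction
along `(𝟙, 0)` coequalizes the first pair. Shifting replaces the second components by an arbitrary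
one, and the same argument in the other variable shows that the kernel of `q₁ × q₂` is contained in
that of `k`. -/
theorem HasPullbackShifting.satisfiesP [L.IsAlgebraic] (h : HasPullbackShifting.{u, v, w} E)
    (X : VarietyAlg.{u, v, w} E) : SatisfiesP (Pt X) := by
  intro C₁ A A' C₂ B B' f f' q₁ g g' q₂ h₁ h₂ c d e hc hd he
  obtain ⟨e₁, univ₁⟩ := isCoequalizerDiagram_iff.1 h₁
  obtain ⟨e₂, univ₂⟩ := isCoequalizerDiagram_iff.1 h₂
  have fst_map (z : d.pt.A) : toHom (Pt.Hom.f e.fst) (toHom (Pt.Hom.f (productMap d he q₁ q₂)) z) =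
      toHom (Pt.Hom.f q₁) (toHom (Pt.Hom.f d.fst) z) :=
    Pt.toHom_congr (productMap_fst d he q₁ q₂) z
  have snd_map (z : d.pt.A) : toHom (Pt.Hom.f e.snd) (toHom (Pt.Hom.f (productMap d he q₁ q₂)) z) =
      toHom (Pt.Hom.f q₂) (toHom (Pt.Hom.f d.snd) z) :=
    Pt.toHom_congr (productMap_snd d he q₁ q₂) z
  have p_fst (z : d.pt.A) : toHom A.p (toHom (Pt.Hom.f d.fst) z) = toHom d.pt.p z :=
    Pt.toHom_f_p d.fst z
  have p_snd (z : d.pt.A) : toHom B.p (toHom (Pt.Hom.f d.snd) z) = toHom d.pt.p z :=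
    Pt.toHom_f_p d.snd z
  refine Pt.isCoequalizerDiagram_of_surjective ?_ ?_ ?_
  · rw [productMap_comp, productMap_comp, e₁, e₂]
  · intro z
    obtain ⟨a, ha⟩ := Pt.coequalizer_surjective h₁ (toHom (Pt.Hom.f e.fst) z)
    obtain ⟨b, hb⟩ := Pt.coequalizer_surjective h₂ (toHom (Pt.Hom.f e.snd) z)
    have hab : toHom A.p a = toHom B.p b := by
      rw [← Pt.toHom_f_p q₁, ← Pt.toHom_f_p q₂, ha, hb]
      exact (Pt.toHom_f_p e.fst z).trans (Pt.toHom_f_p e.snd z).symm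
    refine ⟨toHom (Pt.Hom.f (Pt.prodComparison hd)) ⟨(a, b), hab⟩, Pt.ext_of_isLimit he ?_ ?_⟩
    · exact (fst_map _).trans
        ((congrArg (toHom (Pt.Hom.f q₁)) (Pt.fst_prodComparison hd _)).trans ha)
    · exact (snd_map _).trans
        ((congrArg (toHom (Pt.Hom.f q₂)) (Pt.snd_prodComparison hd _)).trans hb)
  · intro Z k hk z z' hz
    let κ : algPullback (toHom A.p) (toHom B.p) →[L] Z.A :=
      toHom (Pt.Hom.f (Pt.prodComparison hd ≫ k))
    have hκ (z : d.pt.A) {a : A.A} {b : B.A} (ha : toHom (Pt.Hom.f d.fst) z = a)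
        (hb : toHom (Pt.Hom.f d.snd) z = b) (hab : toHom A.p a = toHom B.p b) :
        toHom (Pt.Hom.f k) z = κ ⟨(a, b), hab⟩ :=
      congrArg (toHom (Pt.Hom.f k)) (Pt.ext_of_isLimit hd
        (ha.trans (Pt.fst_prodComparison hd ⟨(a, b), hab⟩).symm)
        (hb.trans (Pt.snd_prodComparison hd ⟨(a, b), hab⟩).symm))
    have hl {a a' : A.A} (haa : toHom (Pt.Hom.f q₁) a = toHom (Pt.Hom.f q₁) a') :
        toHom (Pt.Hom.f (productInl hd ≫ k)) a = toHom (Pt.Hom.f (productInl hd ≫ k)) a' := by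
      obtain ⟨l, hl, -⟩ := univ₁ Z (productInl hd ≫ k) (by
        rw [← Category.assoc, ← Category.assoc, ← productInl_productMap hd hc f g,
          ← productInl_productMap hd hc f' g', Category.assoc, Category.assoc, hk])
      rw [← hl, Pt.comp_f, toHom_comp, toHom_comp, haa]
    have hr {b b' : B.A} (hbb : toHom (Pt.Hom.f q₂) b = toHom (Pt.Hom.f q₂) b') :
        toHom (Pt.Hom.f (productInr hd ≫ k)) b = toHom (Pt.Hom.f (productInr hd ≫ k)) b' := by
      obtain ⟨l, hl, -⟩ := univ₂ Z (productInr hd ≫ k) (by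
        rw [← Category.assoc, ← Category.assoc, ← productInr_productMap hd hc f g,
          ← productInr_productMap hd hc f' g', Category.assoc, Category.assoc, hk])
      rw [← hl, Pt.comp_f, toHom_comp, toHom_comp, hbb]
    have inl_eq (a : A.A) (x : X) (hx : toHom A.p a = x) :
        toHom (Pt.Hom.f (productInl hd ≫ k)) a =
          κ ⟨(a, toHom B.s x), hx.trans (Pt.toHom_s_p B x).symm⟩ := by
      subst hx
      exact hκ _ (Pt.toHom_congr (productInl_fst hd) a) (Pt.toHom_congr (productInl_snd hd) a) _
    have inr_eq (b : B.A) (x : X) (hx : toHom B.p b = x) :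
        toHom (Pt.Hom.f (productInr hd ≫ k)) b =
          κ ⟨(toHom A.s x, b), (Pt.toHom_s_p A x).trans hx.symm⟩ := by
      subst hx
      exact hκ _ (Pt.toHom_congr (productInr_fst hd) b) (Pt.toHom_congr (productInr_snd hd) b) _
    have h1 : toHom (Pt.Hom.f q₁) (toHom (Pt.Hom.f d.fst) z) =
        toHom (Pt.Hom.f q₁) (toHom (Pt.Hom.f d.fst) z') := by rw [← fst_map, ← fst_map, hz]
    have h2 : toHom (Pt.Hom.f q₂) (toHom (Pt.Hom.f d.snd) z) =
        toHom (Pt.Hom.f q₂) (toHom (Pt.Hom.f d.snd) z') := by rw [← snd_map, ← snd_map, hz]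
    have hp : toHom d.pt.p z' = toHom d.pt.p z := by
      rw [← Pt.toHom_f_p (productMap d he q₁ q₂), ← hz, Pt.toHom_f_p]
    rw [hκ z rfl rfl ((p_fst z).trans (p_snd z).symm),
      hκ z' rfl rfl ((p_fst z').trans (p_snd z').symm)]
    refine Eq.trans (b := κ ⟨(toHom (Pt.Hom.f d.fst) z', toHom (Pt.Hom.f d.snd) z),
      (p_fst z').trans (hp.trans (p_snd z).symm)⟩) ?_ ?_
    · refine h.map_eq κ ((p_fst z).trans (Pt.toHom_s_p B _).symm)
        ((p_fst z').trans (hp.trans (Pt.toHom_s_p B _).symm)) _ _ ?_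
      exact (inl_eq _ _ (p_fst z)).symm.trans ((hl h1).trans (inl_eq _ _ ((p_fst z').trans hp)))
    · -- the roles of the two factors are exchanged by composing with the symmetry of the pullback
      let σ : algPullback (toHom B.p) (toHom A.p) →[L] algPullback (toHom A.p) (toHom B.p) :=
        algPullbackLift (algPullbackSnd _ _) (algPullbackFst _ _)
          fun z => (algPullback_condition z).symm
      refine h.map_eq (κ.comp σ) ((p_snd z).trans (Pt.toHom_s_p A _).symm)
        ((p_snd z').trans (hp.trans (Pt.toHom_s_p A _).symm))
        ((p_snd z).trans (hp.symm.trans (p_fst z').symm)) ((p_snd z').trans (p_fst z').symm) ?_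
      exact (inr_eq _ _ (p_snd z)).symm.trans ((hr h2).trans (inr_eq _ _ ((p_snd z').trans hp)))

/-! ### The term condition implies shifting -/

theorem AlgCongruence.realize_rel {M : Type w} [L.Structure M] (R : AlgCongruence L M) {α : Type*}
    (t : L.Term α) {a b : α → M} (h : ∀ i, R.r (a i) (b i)) : R.r (t.realize a) (t.realize b) := by
  induction t with
  | var i => exact h i
  | func F ts ih => exact R.funMap_rel F _ _ ih

theorem map_realize_vecCons {M N : Type*} [L.Structure M] [L.Structure N] (k : M →[L] N) {m : ℕ}
    (p : L.Term (Fin (m + 2))) (x y : M) (e : Fin m → M) :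
    k (p.realize (Matrix.vecCons x (Matrix.vecCons y e))) =
      p.realize (Matrix.vecCons (k x) (Matrix.vecCons (k y) fun j => k (e j))) := by
  rw [← HomClass.realize_term]
  congr 1
  funext i
  refine Fin.cases rfl (fun i => ?_) i
  exact Fin.cases rfl (fun i => rfl) i

theorem map_realize_pair {M N : Type*} [L.Structure M] [L.Structure N] (k : M →[L] N)
    (p : L.Term (Fin 2)) (x y : M) : k (p.realize ![x, y]) = p.realize ![k x, k y] := by
  rw [← HomClass.realize_term]
  congr 1
  funext i
  refine Fin.cases rfl (fun i => ?_) i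
  exact Fin.cases rfl (fun i => i.elim0) i

theorem HasJanelidzeTerms.hasPullbackShifting [L.IsAlgebraic]
    (h : HasJanelidzeTerms.{u, v, w} E) :
    HasPullbackShifting.{u, v, w} E := by
  obtain ⟨m, n, b, c, p, hp⟩ := h
  intro A B X f g C x y t z hxt hyt hxz hyz hC
  -- the pairs `(b j (x, y), c j (t, z))` lie in the pullback, as `b j` and `c j` agree on the
  -- diagonal of `X`
  have he (j : Fin m) : f ((b j).realize ![x, y]) = g ((c j).realize ![t, z]) := by
    rw [map_realize_pair, map_realize_pair, ← hxt, ← hxz, hyt, ← hxt]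
    exact (hp X).2.2.2.2 j _
  let e (j : Fin m) : algPullback f g := ⟨((b j).realize ![x, y], (c j).realize ![t, z]), he j⟩
  let U : algPullback f g := ⟨(x, t), hxt⟩
  let V : algPullback f g := ⟨(y, t), hyt⟩
  let l (i : Fin (n + 1)) := (p i).realize (Matrix.vecCons U (Matrix.vecCons V e))
  let r (i : Fin (n + 1)) := (p i).realize (Matrix.vecCons V (Matrix.vecCons U e))
  have l_fst (i) : algPullbackFst f g (l i) = (p i).realize
      (Matrix.vecCons x (Matrix.vecCons y fun j => (b j).realize ![x, y])) :=
    map_realize_vecCons _ _ _ _ _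
  have r_fst (i) : algPullbackFst f g (r i) = (p i).realize
      (Matrix.vecCons y (Matrix.vecCons x fun j => (b j).realize ![x, y])) :=
    map_realize_vecCons _ _ _ _ _
  have l_snd (i) : algPullbackSnd f g (l i) = z :=
    (map_realize_vecCons _ _ _ _ _).trans ((hp B).2.2.2.1 i t z)
  have r_snd (i) : algPullbackSnd f g (r i) = z :=
    (map_realize_vecCons _ _ _ _ _).trans ((hp B).2.2.2.1 i t z)
  have hlr (i) : C.r (l i) (r i) := by
    refine C.realize_rel (p i) fun k => ?_
    refine Fin.cases hC (fun k => ?_) k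
    exact Fin.cases (C.symm hC) (fun k => C.refl _) k
  have hrl (i : Fin n) : r i.castSucc = l i.succ :=
    algPullback_ext ((r_fst _).trans (((hp A).2.2.1 i x y).trans (l_fst _).symm))
      ((r_snd _).trans (l_snd _).symm)
  have hchain (i) : C.r (l 0) (r i) := by
    induction i using Fin.induction with
    | zero => exact hlr 0
    | succ i ih => exact C.trans ih (hrl i ▸ hlr i.succ)
  have h0 : l 0 = ⟨(x, z), hxz⟩ := algPullback_ext ((l_fst _).trans ((hp A).1 x y)) (l_snd _)
  have h1 : r (Fin.last n) = ⟨(y, z), hyz⟩ :=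
    algPullback_ext ((r_fst _).trans ((hp A).2.1 x y)) (r_snd _)
  exact h0 ▸ h1 ▸ hchain (Fin.last n)

end Shifting

section Terms

open FirstOrder FirstOrder.Language VarietyAlg

variable {L : FirstOrder.Language.{u, v}}

/-! ### Free algebras -/

/-- The absolutely free algebra of terms. It has no relations, which is immaterial as the signatures
in question have no relation symbols. -/
instance termStructure {α : Type*} : L.Structure (L.Term α) where
  funMap F ts := Term.func F ts
  RelMap _ _ := False

section FreeAlgebra

variable (E : Set (L.Term ℕ × L.Term ℕ))

/-- Two terms are congruent if the identity between them holds in the variety. -/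
def identityCongruence (α : Type w) : AlgCongruence L (L.Term α) where
  r s t := ∀ (A : VarietyAlg.{u, v, max u w} E) (a : α → A), s.realize a = t.realize a
  iseqv := ⟨fun _ _ _ => rfl, fun h A a => (h A a).symm, fun h h' A a => (h A a).trans (h' A a)⟩
  funMap_rel F _ _ h A a := congrArg (Structure.funMap F) (funext fun i => h i A a)

variable [L.IsAlgebraic]

/-- The free algebra of the variety on `α`: terms modulo the identities of the variety. -/
def freeAlg (α : Type w) : VarietyAlg.{u, v, max u w} E where
  carrier := Quotient (identityCongruence E α).toSetoid
  sat e he a := by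
    obtain ⟨a, rfl⟩ : ∃ b : ℕ → L.Term α, a = fun i => ⟦b i⟧ :=
      ⟨fun i => (a i).out, funext fun i => (Quotient.out_eq _).symm⟩
    have realize_eq (t : L.Term ℕ) : t.realize a = t.subst a := by
      induction t with
      | var => rfl
      | func F ts ih => exact congrArg (Term.func F) (funext ih)
    rw [Term.realize_quotient_mk', Term.realize_quotient_mk']
    refine Quotient.sound fun A x => ?_
    have := A.sat e he fun i => (a i).realize x
    rwa [← Term.realize_subst, ← Term.realize_subst, ← realize_eq, ← realize_eq] at this

namespace freeAlg

variable {E} {α : Type w}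

/-- The class of a term in the free algebra. -/
def mk (t : L.Term α) : freeAlg E α := (⟦t⟧ : Quotient (identityCongruence E α).toSetoid)

theorem mk_surjective : Function.Surjective (mk : L.Term α → freeAlg E α) := Quotient.mk_surjective

/-- The generators of the free algebra. -/
def of (i : α) : freeAlg E α := mk (Term.var i)

theorem mk_eq_realize (t : L.Term α) : (mk t : freeAlg E α) = t.realize of := by
  have realize_var (t : L.Term α) : t.realize (Term.var : α → L.Term α) = t := by
    induction t with
    | var => rfl
    | func F ts ih => exact congrArg (Term.func F) (funext ih)
  refine Eq.trans ?_ (Term.realize_quotient_mk' (identityCongruence E α).toSetoid t Term.var).symm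
  exact congrArg mk (realize_var t).symm

/-- The homomorphism out of the free algebra with prescribed values on the generators. -/
def lift {A : VarietyAlg.{u, v, max u w} E} (a : α → A) : freeAlg E α ⟶ A :=
  ofHom (homOfMapFun
    (Quotient.lift (s := (identityCongruence E α).toSetoid) (fun t => t.realize a)
      fun _ _ h => h A a) fun F ts => by
    obtain ⟨ts, rfl⟩ : ∃ b : _ → L.Term α, ts = fun i => mk (b i) :=
      ⟨fun i => (ts i).out, funext fun i => (Quotient.out_eq _).symm⟩
    exact congrArg (Quotient.lift (s := (identityCongruence E α).toSetoid) (fun t => t.realize a)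
      fun _ _ h => h A a) (funMap_quotient_mk' (identityCongruence E α).toSetoid F ts))

theorem hom_ext {A : VarietyAlg.{u, v, max u w} E} {f g : freeAlg E α ⟶ A}
    (h : ∀ i, toHom f (of i) = toHom g (of i)) : f = g := by
  refine VarietyAlg.hom_ext fun t => ?_
  obtain ⟨t, rfl⟩ := mk_surjective t
  rw [mk_eq_realize, ← HomClass.realize_term, ← HomClass.realize_term]
  exact congrArg t.realize (funext h)

end freeAlg

end FreeAlgebra

/-! ### Principal congruences -/

section Principal

/-- An elementary step of the principal congruence of `(x, y)`: the passage from `T(x, y)` to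
`T(y, x)` for a term `T` with parameters. -/
def ElementaryStep (L : FirstOrder.Language.{u, v}) {M : Type w} [L.Structure M] (x y a b : M) :
    Prop :=
  ∃ T : L.Term (M ⊕ Fin 2),
    T.realize (Sum.elim id ![x, y]) = a ∧ T.realize (Sum.elim id ![y, x]) = b

variable {M : Type w} [L.Structure M] {x y : M}

theorem ElementaryStep.refl (a : M) : ElementaryStep L x y a a := ⟨Term.var (Sum.inl a), rfl, rfl⟩

theorem ElementaryStep.symm {a b : M} (h : ElementaryStep L x y a b) :
    ElementaryStep L x y b a := by
  obtain ⟨T, rfl, rfl⟩ := h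
  have e (x y : M) : Sum.elim id ![x, y] ∘ Sum.map id Fin.rev = Sum.elim id ![y, x] := by
    funext i
    obtain i | i := i
    · rfl
    · fin_cases i <;> rfl
  exact ⟨T.relabel (Sum.map id Fin.rev), by rw [Term.realize_relabel, e],
    by rw [Term.realize_relabel, e]⟩

theorem ElementaryStep.funMap {n : ℕ} (F : L.Functions n) {a b : Fin n → M}
    (h : ∀ i, ElementaryStep L x y (a i) (b i)) :
    ElementaryStep L x y (Structure.funMap F a) (Structure.funMap F b) := by
  choose T h1 h2 using h
  exact ⟨Term.func F T, congrArg (Structure.funMap F) (funext h1),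
    congrArg (Structure.funMap F) (funext h2)⟩

/-- The arguments of an operation can be changed one at a time, so that the transitive closure of a
reflexive compatible relation is compatible. -/
theorem ElementaryStep.transGen_funMap {n : ℕ} (F : L.Functions n) {a b : Fin n → M}
    (h : ∀ i, Relation.TransGen (ElementaryStep L x y) (a i) (b i)) :
    Relation.TransGen (ElementaryStep L x y) (Structure.funMap F a) (Structure.funMap F b) := by
  have key (s : Finset (Fin n)) : Relation.TransGen (ElementaryStep L x y) (Structure.funMap F a)
      (Structure.funMap F (s.piecewise b a)) := by
    induction s using Finset.induction_on with
    | empty => rw [Finset.piecewise_empty]; exact .single (.refl _)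
    | insert i s hi ih =>
      refine ih.trans ?_
      have e : s.piecewise b a = Function.update (s.piecewise b a) i (a i) := by
        rw [← Finset.piecewise_eq_of_notMem s b a hi, Function.update_eq_self]
      rw [Finset.piecewise_insert]
      nth_rewrite 1 [e]
      refine Relation.TransGen.lift
        (fun z => Structure.funMap F (Function.update (s.piecewise b a) i z)) ?_ _ _ (h i)
      intro z z' hz
      refine ElementaryStep.funMap F fun j => ?_
      obtain rfl | hj := eq_or_ne j i
      · simpa using hz
      · simpa [hj] using ElementaryStep.refl _
  simpa using key Finset.univ

variable (L x y) in
/-- The congruence generated by the pair `(x, y)`, in Mal'cev's description: the transitive closure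
of the elementary steps. -/
def principalCongruence : AlgCongruence L M where
  r := Relation.TransGen (ElementaryStep L x y)
  iseqv := ⟨fun a => .single (.refl a),
    fun h => by
      induction h with
      | single h => exact .single h.symm
      | tail _ h ih => exact .head h.symm ih,
    fun h h' => h.trans h'⟩
  funMap_rel F _ _ h := ElementaryStep.transGen_funMap F h

theorem principalCongruence_self : (principalCongruence L x y).r x y :=
  .single ⟨Term.var (Sum.inr 0), rfl, rfl⟩

/-- A homomorphism that identifies `x` and `y` identifies all pairs of their principal
congruence. -/
theorem principalCongruence_le_ker {N : Type*} [L.Structure N] (f : M →[L] N) (h : f x = f y)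
    {a b : M} (hab : (principalCongruence L x y).r a b) : f a = f b := by
  have step {a b : M} (hab : ElementaryStep L x y a b) : f a = f b := by
    obtain ⟨T, rfl, rfl⟩ := hab
    rw [← HomClass.realize_term, ← HomClass.realize_term]
    congr 1
    funext i
    obtain i | i := i
    · rfl
    · fin_cases i
      · exact h
      · exact h.symm
  induction hab with
  | single hab => exact step hab
  | tail _ hab ih => exact ih.trans (step hab)

theorem realize_congr_varFinset {α : Type*} [DecidableEq α] (t : L.Term α) {a b : α → M}
    (h : ∀ i ∈ t.varFinset, a i = b i) : t.realize a = t.realize b := by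
  induction t with
  | var i => exact h i (by simp [Term.varFinset])
  | func F ts ih =>
    refine congrArg (Structure.funMap F) (funext fun i => ih i fun j hj => h j ?_)
    simp only [Term.varFinset, Finset.mem_biUnion]
    exact ⟨i, Finset.mem_univ i, hj⟩

/-- Finitely many terms with parameters involve only finitely many parameters. -/
theorem exists_finite_parameters {ι : Type*} [Fintype ι] (T : ι → L.Term (M ⊕ Fin 2)) :
    ∃ (m : ℕ) (e : Fin m → M) (p : ι → L.Term (Fin (m + 2))), ∀ (i : ι) (x y : M),
      (p i).realize (Matrix.vecCons x (Matrix.vecCons y e)) =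
        (T i).realize (Sum.elim id ![x, y]) := by
  classical
  let s : Finset M := (Finset.univ.biUnion fun i => (T i).varFinset).toLeft
  -- parameters outside `s` do not occur in the terms, and their images under `ρ` are immaterial
  let ρ : M ⊕ Fin 2 → Fin (s.card + 2) :=
    Sum.elim (fun a => if h : a ∈ s then (s.equivFin ⟨a, h⟩).succ.succ else 0)
      (Fin.castLE (Nat.le_add_left 2 _))
  refine ⟨s.card, fun j => s.equivFin.symm j, fun i => (T i).relabel ρ, fun i x y => ?_⟩
  rw [Term.realize_relabel]
  refine realize_congr_varFinset _ fun a ha => ?_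
  obtain a | k := a
  · have has : a ∈ s := Finset.mem_toLeft.2 (Finset.mem_biUnion.2 ⟨i, Finset.mem_univ i, ha⟩)
    simp [ρ, has]
  · fin_cases k <;> rfl

theorem exists_steps {a b : M} (h : (principalCongruence L x y).r a b) :
    ∃ (n : ℕ) (T : Fin (n + 1) → L.Term (M ⊕ Fin 2)),
      (T 0).realize (Sum.elim id ![x, y]) = a ∧
      (T (Fin.last n)).realize (Sum.elim id ![y, x]) = b ∧
      ∀ i : Fin n, (T i.castSucc).realize (Sum.elim id ![y, x]) =
        (T i.succ).realize (Sum.elim id ![x, y]) := by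
  refine Relation.TransGen.head_induction_on h ?_ ?_
  · rintro a ⟨T, h1, h2⟩
    exact ⟨0, fun _ => T, h1, h2, fun i => i.elim0⟩
  · rintro a c ⟨T₀, h1, h2⟩ - ⟨n, T, h3, h4, h5⟩
    refine ⟨n + 1, Fin.cons T₀ T, h1, h4, fun i => ?_⟩
    refine Fin.cases ?_ (fun i => ?_) i
    · exact h2.trans h3.symm
    · exact h5 i

end Principal

end Terms

section Terms

open FirstOrder FirstOrder.Language VarietyAlg

variable {L : FirstOrder.Language.{u, v}} (E : Set (L.Term ℕ × L.Term ℕ)) [L.IsAlgebraic]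

/-! ### Normal local projections imply the term condition -/

/-- The free algebra on `Fin 2` as a point over the free algebra on one generator: the projection
identifies the generators and the section picks the first one. -/
def freePt : Pt (freeAlg.{u, v, w} E PUnit.{w + 1}) where
  A := freeAlg E (ULift.{w} (Fin 2))
  p := freeAlg.lift fun _ => freeAlg.of PUnit.unit
  s := freeAlg.lift fun _ => freeAlg.of ⟨0⟩
  s_p := freeAlg.hom_ext fun _ => rfl

variable {E}

/-- In the square of `freePt E`, write `x, y` for the generators. The second projection is the
cokernel of `(𝟙, 0) : a ↦ (a, s p a)`. This is the homomorphism with `x ↦ (x, x)` and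
`y ↦ (y, x)`, so that modulo the principal congruence of
`((x, x), (y, x))` it agrees with `a ↦ (s p a, s p a)`. Hence this congruence contains the kernel of
the second projection. -/
theorem HasNormalProjections.principalCongruence_rel
    (h : HasNormalProjections (Pt (freeAlg.{u, v, w} E PUnit.{w + 1})))
    {a b : (Pt.prod (freePt.{u, v, w} E) (freePt E)).A}
    (hab : algPullbackSnd _ _ a = algPullbackSnd _ _ b) :
    (principalCongruence L (M := (Pt.prod (freePt.{u, v, w} E) (freePt E)).A)
      ⟨(freeAlg.of ⟨0⟩, freeAlg.of ⟨0⟩), rfl⟩ ⟨(freeAlg.of ⟨1⟩, freeAlg.of ⟨0⟩), rfl⟩).r a b := by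
  set S := Pt.prod (freePt.{u, v, w} E) (freePt E)
  set U : S.A := ⟨(freeAlg.of ⟨0⟩, freeAlg.of ⟨0⟩), rfl⟩
  set V : S.A := ⟨(freeAlg.of ⟨1⟩, freeAlg.of ⟨0⟩), rfl⟩
  let hS := Pt.prodFanIsLimit (freePt.{u, v, w} E) (freePt E)
  obtain ⟨Q, π, -, hπ⟩ := Pt.exists_quotient S (principalCongruence L U V)
    fun a b hr => principalCongruence_le_ker (toHom S.p) (show toHom S.p U = toHom S.p V from rfl) hr
  have hUV : toHom (Pt.Hom.f π) U = toHom (Pt.Hom.f π) V := (hπ U V).2 principalCongruence_self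
  have hinl : productInl hS ≫ π = 0 := by
    refine Pt.hom_ext (freeAlg.hom_ext fun i => ?_)
    have h0 : toHom (Pt.Hom.f (0 : freePt E ⟶ Q)) (freeAlg.of i) = toHom (Pt.Hom.f π) U :=
      (Pt.toHom_s_f π (freeAlg.of PUnit.unit)).symm
    refine Eq.trans ?_ h0.symm
    obtain ⟨i⟩ := i
    fin_cases i
    · rfl
    · exact hUV.symm
  obtain ⟨l, rfl⟩ := exists_snd_comp_eq hS (h _ hS).2 π hinl
  exact (hπ _ _).1 (congrArg (toHom (Pt.Hom.f l)) hab)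

/-- The pairs `(x, y)` and `(y, y)` have the same second component, hence are linked by a chain of
elementary steps. Its terms are the `p i`; the components of its parameters, written as terms in the
two generators, are the `b j` and `c j`. -/
theorem HasNormalProjections.hasJanelidzeTerms
    (h : HasNormalProjections (Pt (freeAlg.{u, v, w} E PUnit.{w + 1}))) :
    HasJanelidzeTerms.{u, v, max u w} E := by
  let S := Pt.prod (freePt.{u, v, w} E) (freePt E)
  let x : freeAlg.{u, v, w} E (ULift.{w} (Fin 2)) := freeAlg.of ⟨0⟩
  let y : freeAlg.{u, v, w} E (ULift.{w} (Fin 2)) := freeAlg.of ⟨1⟩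
  let U : S.A := ⟨(x, x), rfl⟩
  let V : S.A := ⟨(y, x), rfl⟩
  let fst : S.A →[L] freeAlg.{u, v, w} E (ULift.{w} (Fin 2)) := algPullbackFst _ _
  let snd : S.A →[L] freeAlg.{u, v, w} E (ULift.{w} (Fin 2)) := algPullbackSnd _ _
  obtain ⟨n, T, hT0, hTn, hT⟩ := exists_steps
    (HasNormalProjections.principalCongruence_rel h (a := ⟨(x, y), rfl⟩) (b := ⟨(y, y), rfl⟩) rfl)
  obtain ⟨m, e, p, hp⟩ := exists_finite_parameters T
  choose b hb using fun j => freeAlg.mk_surjective (fst (e j))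
  choose c hc using fun j => freeAlg.mk_surjective (snd (e j))
  replace hT0 : (p 0).realize (Matrix.vecCons U (Matrix.vecCons V e)) = ⟨(x, y), rfl⟩ :=
    (hp 0 U V).trans hT0
  replace hTn : (p (Fin.last n)).realize (Matrix.vecCons V (Matrix.vecCons U e)) =
      ⟨(y, y), rfl⟩ := (hp _ V U).trans hTn
  replace hT (i : Fin n) : (p i.castSucc).realize (Matrix.vecCons V (Matrix.vecCons U e)) =
      (p i.succ).realize (Matrix.vecCons U (Matrix.vecCons V e)) :=
    (hp _ V U).trans ((hT i).trans (hp _ U V).symm)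
  -- the second component stays constant along the chain, since it does in each step
  have hsnd (i : Fin (n + 1)) :
      snd ((p i).realize (Matrix.vecCons U (Matrix.vecCons V e))) = y := by
    induction i using Fin.induction with
    | zero => exact congrArg snd hT0
    | succ i ih =>
      rw [← ih]
      refine (congrArg snd (hT i)).symm.trans ?_
      exact (map_realize_vecCons snd _ _ _ _).trans
        (map_realize_vecCons snd (p i.castSucc) U V e).symm
  refine ⟨m, n, fun j => (b j).relabel ULift.down, fun j => (c j).relabel ULift.down, p,
    fun A => ?_⟩
  let ev (s t : A) : freeAlg.{u, v, w} E (ULift.{w} (Fin 2)) →[L] A :=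
    toHom (freeAlg.lift (![s, t] ∘ ULift.down))
  have ev_b (s t : A) (j : Fin m) :
      ev s t (fst (e j)) = ((b j).relabel ULift.down).realize ![s, t] := by
    rw [← hb, Term.realize_relabel]
    rfl
  have ev_c (s t : A) (j : Fin m) :
      ev s t (snd (e j)) = ((c j).relabel ULift.down).realize ![s, t] := by
    rw [← hc, Term.realize_relabel]
    rfl
  have left (s t : A) (i : Fin (n + 1)) :
      ev s t (fst ((p i).realize (Matrix.vecCons U (Matrix.vecCons V e)))) =
        (p i).realize (Matrix.vecCons s
          (Matrix.vecCons t fun j => ((b j).relabel ULift.down).realize ![s, t])) := by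
    simp only [← ev_b]
    exact map_realize_vecCons ((ev s t).comp fst) _ _ _ _
  have right (s t : A) (i : Fin (n + 1)) :
      ev s t (fst ((p i).realize (Matrix.vecCons V (Matrix.vecCons U e)))) =
        (p i).realize (Matrix.vecCons t
          (Matrix.vecCons s fun j => ((b j).relabel ULift.down).realize ![s, t])) := by
    simp only [← ev_b]
    exact map_realize_vecCons ((ev s t).comp fst) _ _ _ _
  refine ⟨fun s t => ?_, fun s t => ?_, fun i s t => ?_, fun i s t => ?_, fun j z => ?_⟩
  · rw [← left]
    exact congrArg (fun z => ev s t (fst z)) hT0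
  · rw [← right]
    exact congrArg (fun z => ev s t (fst z)) hTn
  · rw [← left, ← right]
    exact congrArg (fun z => ev s t (fst z)) (hT i)
  · refine Eq.trans ?_ (congrArg (ev s t) (hsnd i))
    simp only [← ev_c]
    exact (map_realize_vecCons ((ev s t).comp snd) (p i) U V e).symm
  · -- the components of a parameter agree in the free algebra on one generator
    have ev_p (a : freeAlg.{u, v, w} E (ULift.{w} (Fin 2))) : ev z z a =
        toHom (freeAlg.lift fun _ => z) (toHom (freePt E).p a) := by
      refine congrArg (fun f : freeAlg.{u, v, w} E (ULift.{w} (Fin 2)) ⟶ A => toHom f a)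
        (freeAlg.hom_ext (g := (freePt E).p ≫ freeAlg.lift fun _ => z) fun i => ?_)
      obtain ⟨i⟩ := i
      fin_cases i <;> rfl
    rw [← ev_b, ← ev_c, ev_p, ev_p]
    exact congrArg _ (algPullback_condition (e j))

end Terms

theorem mainTheorem2 {L : FirstOrder.Language.{u, v}} [L.IsAlgebraic] (E : Set (L.Term ℕ × L.Term ℕ)) :
    List.TFAE
      [∀ X : VarietyAlg.{u, v, max u w} E, SatisfiesP (Pt X),
       ∀ X : VarietyAlg.{u, v, max u w} E, NormalEpisClosedUnderProducts (Pt X),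
       ∀ X : VarietyAlg.{u, v, max u w} E, HasNormalProjections (Pt X),
       HasJanelidzeTerms.{u, v, max u w} E,
       HasPullbackShifting.{u, v, max u w} E] := by
  tfae_have 1 → 2 := fun h X => SatisfiesP.normalEpisClosedUnderProducts (h X)
  tfae_have 2 → 3 := fun h X => NormalEpisClosedUnderProducts.hasNormalProjections (h X)
  tfae_have 3 → 4 := fun h => HasNormalProjections.hasJanelidzeTerms (h _)
  tfae_have 4 → 5 := HasJanelidzeTerms.hasPullbackShifting
  tfae_have 5 → 1 := HasPullbackShifting.satisfiesP
  tfae_finish
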